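/- Let $(S,+)$ be a commutative semigroup with neutral element $0$, directed by $s\le t :\Leftrightarrow \exists r\in S:\ s+r=t$. Let $E$ be a complex Banach space, let $\mathscr L(E)$ be the Banach algebra of bounded linear operators on $E$ with the operator norm, and let $T\colon S\to\mathscr L(E)$, $s\mapsto T_s$, be a bounded representation, i.e. $T_{s+t}=T_sT_t$ for all $s,t\in S$, $T_0=\mathrm{Id}_E$ and $\sup_{s\in S}\|T_s\|<\infty$. Regard $(T_s)_{s\in S}$ as a net. Let $S^*_{\mathrm{uni}}$ be the set of unitary characters, i.e. maps $\chi\colon S\to\{z\in\mathbb C: |z|=1\}$ with $\chi(s+t)=\chi(s)\chi(t)$ and $\chi(0)=1$. We use the following notions. - $\mathscr T_\infty:=\bigcap_{s_0\in S}\overline{\{T_s: s\ge s_0\}}$ (operator norm closures) is the semigroup at infinity. - For $\chi\in S^*_{\mathrm{uni}}$, $\ker(\chi-T):=\{x\in E: T_sx=\chi(s)x \text{ for all } s\in S\}$. - For a bounded representation $R$ of $S$ on a complex Banach space $F$, the unitary spectrum $\sigma_{\mathrm{uni}}(R)$ is the set of all $\chi\in S^*_{\mathrm{uni}}$ such that the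 left ideal of $\mathscr L(F)$ generated by $\{\chi(s)\mathrm{Id}_F-R_s: s\in S\}$ is not all of $\mathscr L(F)$. - $\chi\in S^*_{\mathrm{uni}}$ is a pole of $T$ if there is a projection $P\in\mathscr L(E)$ with range $\ker(\chi-T)$ such that $PT_s=T_sP$ for all $s\in S$ and $\chi\notin\sigma_{\mathrm{uni}}(T|_{\ker P})$. - A bounded representation $R\colon S\to\mathscr L(E)$ is uniformly mean ergodic if the operator norm closed convex hull $\mathcal C$ of $\{R_s:s\in S\}$ contains an element $P$ with $QP=PQ=P$ for all $Q\in\mathcal C$; $T$ is totally uniformly mean ergodic if $\chi T\colon s\mapsto\chi(s)T_s$ is uniformly mean ergodic for every $\chi\in S^*_{\mathrm{uni}}$. - An ideal of a commutative semigroup $C$ is a non-empty subset $I\subseteq C$ with $cd\in I$ for all $c\in C$, $d\in I$. Then the following assertions are equivalent. (a) $\mathscr T_\infty$ is non-empty and compact in operator norm. (b) Every subnet of $(T_s)_{s\in S}$ has a subnet that converges in operator norm. (c) The semigroup $\overline{T(S)}$ (operator norm closure, with operator multiplication) contains an ideal that is compact in operator norm. (d) There is a non-empty set $C\subseteq\mathscr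 L(E)$ that is relatively compact in operator norm and satisfies $\operatorname{dist}(T_s,C)\to 0$ along the net. (e) $T$ is totally uniformly mean ergodic. (f) Every $\chi\in\sigma_{\mathrm{uni}}(T)$ is a pole of $T$. (g) There is a decomposition $E=E_{\mathrm r}\oplus E_{\mathrm s}$ into closed $T$-invariant subspaces such that $E_{\mathrm r}=\bigoplus_{k=1}^n\ker(\chi_k-T)$ for some $n\ge 0$ and $\chi_1,\dots,\chi_n\in S^*_{\mathrm{uni}}$, and the net $(T_s|_{E_{\mathrm s}})_{s\in S}$ converges to $0$ in operator norm. -/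

import Mathlib

open Filter Topology

universe u v w

namespace SemigroupRep

noncomputable section

/-- The canonical reflexive and transitive relation of a commutative monoid `(S, +, 0)`:
`s ≤ t` if and only if `s + r = t` for some `r`. -/
@[reducible]
def algPreorder (S : Type u) [AddCommMonoid S] : Preorder S where
  le s t := ∃ r, s + r = t
  le_refl s := ⟨0, add_zero s⟩
  le_trans := by
    rintro a b c ⟨r, rfl⟩ ⟨q, rfl⟩
    exact ⟨r + q, (add_assoc a r q).symm⟩

/-- The filter "`s → ∞`" on `S`, along which nets indexed by `S` converge. -/
def atInfty (S : Type u) [AddCommMonoid S] : Filter S :=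
  @Filter.atTop S (algPreorder S)

/-- Representations of the commutative monoid `(S, +, 0)` in a unital algebra `A`:
`T (s + t) = T s * T t` and `T 0 = 1`. -/
abbrev Rep (S : Type u) [AddCommMonoid S] (A : Type v) [Monoid A] :=
  Multiplicative S →* A

/-- Unitary semigroup characters of `S`. -/
abbrev UnitaryChar (S : Type u) [AddCommMonoid S] :=
  Multiplicative S →* Circle

section Basic

variable {S : Type u} [AddCommMonoid S]

/-- The operator (or algebra element) `T_s`. -/
abbrev app {A : Type v} [Monoid A] (T : Rep S A) (s : S) : A :=
  T (Multiplicative.ofAdd s)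

/-- The complex number `χ(s)`. -/
abbrev charVal (χ : UnitaryChar S) (s : S) : ℂ :=
  ((χ (Multiplicative.ofAdd s) : Circle) : ℂ)

/-- The representation `T` is bounded: `sup_s ‖T_s‖ < ∞`. -/
def IsBoundedRep {A : Type v} [NormedRing A] (T : Rep S A) : Prop :=
  ∃ M : ℝ, ∀ s : S, ‖app T s‖ ≤ M

/-- The unitary spectrum: all unitary characters `χ` such that the left ideal generated by
`{χ(s) - T_s | s ∈ S}` is not the whole algebra (`Ideal` means left ideal in a
noncommutative ring). -/
def unitarySpectrum {A : Type v} [NormedRing A] [NormedAlgebra ℂ A] (T : Rep S A) :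
    Set (UnitaryChar S) :=
  {χ | Ideal.span (Set.range fun s : S => algebraMap ℂ A (charVal χ s) - app T s) ≠ ⊤}

end Basic

section Operators

variable {S : Type u} [AddCommMonoid S] {E : Type v} [NormedAddCommGroup E] [NormedSpace ℂ E]

/-- The rotated representation `χT : s ↦ χ(s) T_s`. -/
def twist (χ : UnitaryChar S) (T : Rep S (E →L[ℂ] E)) : Rep S (E →L[ℂ] E) where
  toFun s := (χ s : ℂ) • T s
  map_one' := by simp
  map_mul' s t := by
    rw [map_mul, map_mul, Circle.coe_mul, smul_mul_smul_comm]

/-- The subspace `F` is invariant under all the operators `T_s`. -/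
def IsInvariant (T : Rep S (E →L[ℂ] E)) (F : Submodule ℂ E) : Prop :=
  ∀ s : S, ∀ x ∈ F, app T s x ∈ F

/-- The restricted representation `T|_F` on an invariant subspace `F`. -/
def restrict (T : Rep S (E →L[ℂ] E)) (F : Submodule ℂ E) (hF : IsInvariant T F) :
    Rep S (F →L[ℂ] F) where
  toFun s := (T s).restrict (hF s.toAdd)
  map_one' := by
    ext x
    simp
  map_mul' s t := by
    ext x
    simp

/-- The eigenspace `ker(χ - T) = {x | T_s x = χ(s) x for all s}`. -/
def eigenspace (χ : UnitaryChar S) (T : Rep S (E →L[ℂ] E)) : Submodule ℂ E where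
  carrier := {x | ∀ s : S, app T s x = charVal χ s • x}
  add_mem' := by
    intro x y hx hy s
    rw [map_add, hx s, hy s, smul_add]
  zero_mem' := by
    intro s
    rw [map_zero, smul_zero]
  smul_mem' := by
    intro c x hx s
    rw [map_smul, hx s, smul_comm]

/-- The character `χ` is a pole of `T`: there is a bounded projection `P` onto `ker(χ - T)`
that commutes with all `T_s` and such that `χ` is not in the unitary spectrum of the restriction
of `T` to `ker P` (which is invariant since `P` and `T` commute). -/
def IsPole (χ : UnitaryChar S) (T : Rep S (E →L[ℂ] E)) : Prop :=
  ∃ P : E →L[ℂ] E,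
    P * P = P ∧
    (P : E →ₗ[ℂ] E).range = eigenspace χ T ∧
    (∀ s : S, P * app T s = app T s * P) ∧
    ∃ h : IsInvariant T (P : E →ₗ[ℂ] E).ker,
      χ ∉ unitarySpectrum (A := (P : E →ₗ[ℂ] E).ker →L[ℂ] (P : E →ₗ[ℂ] E).ker)
        (restrict T (P : E →ₗ[ℂ] E).ker h)

/-- Uniform mean ergodicity: the operator norm closed convex hull of `T(S)` has a zero element. -/
def IsUniformlyMeanErgodic (T : Rep S (E →L[ℂ] E)) : Prop :=
  ∃ P ∈ closure (convexHull ℝ (Set.range (app T))),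
    ∀ R ∈ closure (convexHull ℝ (Set.range (app T))), R * P = P ∧ P * R = P

/-- Total uniform mean ergodicity: all rotated representations are uniformly mean ergodic. -/
def IsTotallyUniformlyMeanErgodic (T : Rep S (E →L[ℂ] E)) : Prop :=
  ∀ χ : UnitaryChar S, IsUniformlyMeanErgodic (twist χ T)

/-- The semigroup at infinity: the intersection over `s₀` of the operator norm closures of
`{T_s | s ≥ s₀}`. -/
def semigroupAtInfinity (T : Rep S (E →L[ℂ] E)) : Set (E →L[ℂ] E) :=
  ⋂ s₀ : S, closure (app T '' {s | (algPreorder S).le s₀ s})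

/-- Every subnet of `(T_s)` has an operator norm convergent subnet. A subnet is given by a
(nonempty) directed set and a map into the original index set that eventually lies above each
of its elements. The universe parameter `w` is arbitrary, so the index sets may be as large as
one wishes. -/
def EverySubnetHasConvergentSubnet (T : Rep S (E →L[ℂ] E)) : Prop :=
  ∀ (J : Type (max u w)) [Preorder J] [IsDirectedOrder J] [Nonempty J] (h : J → S),
    Tendsto h atTop (atInfty S) →
    ∃ (K : Type (max u w)) (_ : Preorder K) (_ : IsDirectedOrder K) (_ : Nonempty K) (k : K → J),
      Tendsto k atTop atTop ∧
      ∃ L : E →L[ℂ] E, Tendsto (fun i => app T (h (k i))) atTop (𝓝 L)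

/-- The set `I` is a semigroup ideal of the multiplicative commutative semigroup `C`. -/
def IsSemigroupIdeal (C I : Set (E →L[ℂ] E)) : Prop :=
  I ⊆ C ∧ I.Nonempty ∧ ∀ c ∈ C, ∀ d ∈ I, c * d ∈ I

/-- Constrictivity in norm: some nonempty relatively compact set `C` of operators satisfies
`dist(T_s, C) → 0`. -/
def IsNormConstrictive (T : Rep S (E →L[ℂ] E)) : Prop :=
  ∃ C : Set (E →L[ℂ] E), C.Nonempty ∧ IsCompact (closure C) ∧
    Tendsto (fun s => Metric.infDist (app T s) C) (atInfty S) (𝓝 0)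

/-- There is a decomposition `E = Er ⊕ Es` into closed invariant subspaces such that `Er` is the
direct sum of finitely many (possibly zero) eigenspaces belonging to unitary characters and
`(T_s|_Es)` converges to `0` in operator norm. -/
def HasSpectralDecomposition (T : Rep S (E →L[ℂ] E)) : Prop :=
  ∃ Er Es : Submodule ℂ E,
    IsClosed (Er : Set E) ∧ IsClosed (Es : Set E) ∧ IsCompl Er Es ∧
    IsInvariant T Er ∧
    (∃ (n : ℕ) (χ : Fin n → UnitaryChar S),
      iSupIndep (fun k => eigenspace (χ k) T) ∧ Er = ⨆ k, eigenspace (χ k) T) ∧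
    ∃ hs : IsInvariant T Es,
      Tendsto (fun s => app (restrict T Es hs) s) (atInfty S) (𝓝 0)

end Operators

end

end SemigroupRep

/-! Two mechanisms carry the equivalence.

Compactness: the first four assertions all say that $(T_s)$ converges along every ultrafilter finer
than its filter at infinity, and this form (`ConvergesAlongUltrafilters`) mediates between them. The
return from a compact ideal $I$ uses an idempotent $P\in I$: once some $T_{s_0}$ is close to $P$,
the factor $(T_{s_0}-P)(1-P)$ keeps $T_s$ near $T_sP\in I$ for all later $s$.

Spectral theory: by commutativity and boundedness, the hull of $T(S)$ contains a net of averages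
$a_i$ with $(1-T_s)a_i\to 0$. Multiplied by an element of $\mathscr T_\infty$ they stay in a norm
compact convex set, and a limit point is the mean ergodic projection; rotation by a character
preserves the compactness hypothesis. The same averages show that
$\chi\notin\sigma_{\mathrm{uni}}(T)$ means that $0$ lies in the closed convex hull of $\chi^{-1}T$,
which turns poles into mean ergodicity (`isPole_iff`).

From total mean ergodicity, Gelfand theory in the bicommutant of $T(S)$ yields the decomposition:
compactness of the character space leaves only finitely many mean ergodic projections, and off their
ranges some $T_{s_0}$ has spectral radius below one (`exists_finset_tendsto_zero`). A decomposition
in turn places $T_s$ asymptotically in the compact set of combinations $\sum z_k\pi_k$ with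
$|z_k|\le 1$. -/

namespace SemigroupRep

/-! ### The filter at infinity and elementary rules for representations and characters -/

section AtInfty

variable {S : Type u} [AddCommMonoid S]

lemma mem_atInfty_iff {X : Set S} : X ∈ atInfty S ↔ ∃ s₀ : S, ∀ r : S, s₀ + r ∈ X := by
  let _ : Preorder S := algPreorder S
  have _ : IsDirectedOrder S :=
    ⟨fun a b => ⟨a + b, ⟨b, rfl⟩, ⟨a, add_comm b a⟩⟩⟩
  change X ∈ (atTop : Filter S) ↔ _
  rw [Filter.mem_atTop_sets]
  refine exists_congr fun s₀ => ⟨fun h r => h _ ⟨r, rfl⟩, ?_⟩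
  rintro h _ ⟨r, rfl⟩
  exact h r

instance atInfty_neBot : (atInfty S).NeBot := by
  refine Filter.neBot_iff.2 fun h => ?_
  have : (∅ : Set S) ∈ atInfty S := by rw [h]; exact Filter.mem_bot
  obtain ⟨s₀, hs⟩ := mem_atInfty_iff.1 this
  exact hs 0

lemma setOf_le_mem_atInfty (s₀ : S) : {s | (algPreorder S).le s₀ s} ∈ atInfty S :=
  mem_atInfty_iff.2 ⟨s₀, fun r => ⟨r, rfl⟩⟩

lemma app_add {A : Type v} [Monoid A] (T : Rep S A) (s t : S) :
    app T (s + t) = app T s * app T t := map_mul T _ _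

lemma app_zero {A : Type v} [Monoid A] (T : Rep S A) : app T 0 = 1 := map_one T

lemma app_comm {A : Type v} [Monoid A] (T : Rep S A) (s t : S) :
    app T s * app T t = app T t * app T s := by
  rw [← app_add, ← app_add, add_comm]

lemma app_nsmul {A : Type v} [Monoid A] (T : Rep S A) (n : ℕ) (s : S) :
    app T (n • s) = app T s ^ n := map_pow T (Multiplicative.ofAdd s) n

lemma app_sum {A : Type v} [CommMonoid A] (T : Rep S A) (F : Finset S) :
    app T (∑ s ∈ F, s) = ∏ s ∈ F, app T s := by
  simp [app, ofAdd_sum, map_prod]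

lemma norm_charVal (χ : UnitaryChar S) (s : S) : ‖charVal χ s‖ = 1 := Circle.norm_coe _

lemma charVal_ne_zero (χ : UnitaryChar S) (s : S) : charVal χ s ≠ 0 := Circle.coe_ne_zero _

lemma charVal_inv (χ : UnitaryChar S) (s : S) : charVal χ⁻¹ s = (charVal χ s)⁻¹ :=
  Circle.coe_inv _

lemma charVal_injective {χ ψ : UnitaryChar S} (h : ∀ s, charVal χ s = charVal ψ s) : χ = ψ := by
  refine MonoidHom.ext fun s => Circle.ext (h s.toAdd)

end AtInfty

/-! ### The closed convex hull, ergodic nets and the unitary spectrum -/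

section ClosedHull

variable {S : Type u} [AddCommMonoid S] {E : Type v} [NormedAddCommGroup E] [NormedSpace ℂ E]
  {T : Rep S (E →L[ℂ] E)}

/-- The operator norm closed convex hull of `T(S)`. -/
abbrev closedHull (T : Rep S (E →L[ℂ] E)) : Set (E →L[ℂ] E) :=
  closure (convexHull ℝ (Set.range (app T)))

lemma app_twist (χ : UnitaryChar S) (T : Rep S (E →L[ℂ] E)) (s : S) :
    app (twist χ T) s = charVal χ s • app T s := rfl

lemma IsBoundedRep.twist (hT : IsBoundedRep T) (χ : UnitaryChar S) :
    IsBoundedRep (twist χ T) := by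
  obtain ⟨M, hM⟩ := hT
  refine ⟨M, fun s => ?_⟩
  rw [app_twist, norm_smul, norm_charVal, one_mul]
  exact hM s

lemma IsBoundedRep.restrict (hT : IsBoundedRep T) {F : Submodule ℂ E} (hF : IsInvariant T F) :
    IsBoundedRep (A := F →L[ℂ] F) (restrict T F hF) := by
  obtain ⟨M, hM⟩ := hT
  refine ⟨M, fun s => ContinuousLinearMap.opNorm_le_bound _ ((norm_nonneg _).trans (hM s))
    fun x => ?_⟩
  exact ((app T s).le_opNorm x).trans (mul_le_mul_of_nonneg_right (hM s) (norm_nonneg _))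

lemma app_mem_closedHull (T : Rep S (E →L[ℂ] E)) (s : S) : app T s ∈ closedHull T :=
  subset_closure (subset_convexHull ℝ _ ⟨s, rfl⟩)

lemma convex_closedHull (T : Rep S (E →L[ℂ] E)) : Convex ℝ (closedHull T) :=
  (convex_convexHull ℝ _).closure

/-- Serves as an induction principle: a closed convex condition need only be checked on the
operators $T_s$. -/
lemma closedHull_subset {X : Set (E →L[ℂ] E)} (hX : IsClosed X) (hc : Convex ℝ X)
    (h : ∀ s, app T s ∈ X) : closedHull T ⊆ X :=
  closure_minimal (convexHull_min (Set.range_subset_iff.2 h) hc) hX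

lemma mul_mem_closedHull {a b : E →L[ℂ] E} (ha : a ∈ closedHull T) (hb : b ∈ closedHull T) :
    a * b ∈ closedHull T := by
  have h1 : ∀ s : S, ∀ b : E →L[ℂ] E, b ∈ closedHull T → app T s * b ∈ closedHull T :=
    fun s _ hb =>
    closedHull_subset (T := T) (X := {b | app T s * b ∈ closedHull T})
      (isClosed_closure.preimage (by fun_prop))
      (fun x hx y hy c d hc hd hcd => by
        simpa [mul_add] using convex_closedHull T hx hy hc hd hcd)
      (fun t => by
        change app T s * app T t ∈ closedHull T
        rw [← app_add]
        exact app_mem_closedHull T _) hb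
  exact closedHull_subset (T := T) (X := {a | a * b ∈ closedHull T})
      (isClosed_closure.preimage (by fun_prop))
      (fun x hx y hy c d hc hd hcd => by
        simpa [add_mul] using convex_closedHull T hx hy hc hd hcd) (fun t => h1 t b hb) ha

lemma commute_of_mem_closedHull {a c : E →L[ℂ] E} (ha : a ∈ closedHull T)
    (hc : ∀ s, app T s * c = c * app T s) : a * c = c * a :=
  closedHull_subset (T := T) (X := {a | a * c = c * a})
    (isClosed_eq (by fun_prop) (by fun_prop))
    (fun x hx y hy p q _ _ _ => by
      simp only [Set.mem_ofPred_eq] at hx hy ⊢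
      rw [add_mul, mul_add, smul_mul_assoc, smul_mul_assoc, mul_smul_comm, mul_smul_comm, hx, hy])
    hc ha

lemma closedHull_comm {a b : E →L[ℂ] E} (ha : a ∈ closedHull T) (hb : b ∈ closedHull T) :
    a * b = b * a :=
  commute_of_mem_closedHull ha fun s =>
    (commute_of_mem_closedHull hb fun t => app_comm T t s).symm

lemma norm_le_of_mem_closedHull {M : ℝ} (hM : ∀ s, ‖app T s‖ ≤ M) {a : E →L[ℂ] E}
    (ha : a ∈ closedHull T) : ‖a‖ ≤ M := by
  have h := closedHull_subset (T := T) (X := Metric.closedBall 0 M) Metric.isClosed_closedBall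
    (convex_closedBall 0 M) (fun s => mem_closedBall_zero_iff.2 (hM s)) ha
  exact mem_closedBall_zero_iff.1 h

/-- Cesàro means of the powers of $T_s$ work: the product telescopes to $(1-T_s^n)/n$, of norm at
most $2M/n$. -/
lemma exists_average (hT : IsBoundedRep T) (s : S) {ε : ℝ} (hε : 0 < ε) :
    ∃ a ∈ closedHull T, ‖(1 - app T s) * a‖ < ε := by
  obtain ⟨M, hM⟩ := hT
  obtain ⟨n, hn⟩ := exists_nat_gt ((M + M) / ε)
  have hM0 : 0 ≤ M := (norm_nonneg _).trans (hM 0)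
  have hn0 : (0 : ℝ) < n := lt_of_le_of_lt (by positivity) hn
  refine ⟨∑ k ∈ Finset.range n, (n : ℝ)⁻¹ • app T s ^ k, ?_, ?_⟩
  · refine (convex_closedHull T).sum_mem (fun _ _ => by positivity) ?_ fun k _ => ?_
    · simp [hn0.ne']
    · rw [← app_nsmul]
      exact app_mem_closedHull T _
  · rw [← Finset.smul_sum, mul_smul_comm, mul_neg_geom_sum, norm_smul, norm_inv,
      Real.norm_of_nonneg hn0.le, inv_mul_lt_iff₀ hn0]
    refine lt_of_le_of_lt (norm_sub_le _ _) ?_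
    rw [← app_zero T, ← app_nsmul]
    rw [div_lt_iff₀ hε] at hn
    linarith [hM 0, hM (n • s)]

/-- Multiply the averages for the individual $s$: they commute and are bounded by $M$, so each
factor keeps its effect in the product. -/
lemma exists_average_finset (hT : IsBoundedRep T) (F : Finset S) {ε : ℝ} (hε : 0 < ε) :
    ∃ a ∈ closedHull T, ∀ s ∈ F, ‖(1 - app T s) * a‖ < ε := by
  classical
  induction F using Finset.induction_on generalizing ε with
  | empty => exact ⟨1, app_zero T ▸ app_mem_closedHull T 0, by simp⟩
  | insert t F _ ih =>
    obtain ⟨M, hM⟩ := id hT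
    have hM0 : 0 ≤ M := (norm_nonneg _).trans (hM 0)
    have hε' : 0 < ε / (M + 1) := by positivity
    have key : ∀ x a b : E →L[ℂ] E, ‖x * a‖ < ε / (M + 1) → b ∈ closedHull T →
        ‖x * (a * b)‖ < ε := by
      intro x a b h hb
      have hb' := norm_le_of_mem_closedHull hM hb
      calc ‖x * (a * b)‖ ≤ ‖x * a‖ * ‖b‖ := by rw [← mul_assoc]; exact norm_mul_le _ _
        _ ≤ ε / (M + 1) * M := mul_le_mul h.le hb' (norm_nonneg _) hε'.le
        _ < ε / (M + 1) * (M + 1) := by gcongr; linarith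
        _ = ε := by field_simp
    obtain ⟨a, ha, haF⟩ := ih hε'
    obtain ⟨b, hb, hbt⟩ := exists_average hT t hε'
    refine ⟨a * b, mul_mem_closedHull ha hb, fun s hs => ?_⟩
    rcases Finset.mem_insert.1 hs with rfl | hs
    · rw [closedHull_comm ha hb]
      exact key _ _ _ hbt ha
    · exact key _ _ _ (haF s hs) hb

lemma exists_average_net (hT : IsBoundedRep T) :
    ∃ a : Finset S × ℕ → E →L[ℂ] E, (∀ i, a i ∈ closedHull T) ∧
      ∀ s, Tendsto (fun i => (1 - app T s) * a i) atTop (𝓝 0) := by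
  choose a ha h using fun i : Finset S × ℕ =>
    exists_average_finset hT i.1 (Nat.one_div_pos_of_nat (α := ℝ) (n := i.2))
  refine ⟨a, ha, fun s => ?_⟩
  refine Metric.tendsto_nhds.2 fun ε hε => ?_
  obtain ⟨n, hn⟩ := exists_nat_one_div_lt hε
  filter_upwards [Ici_mem_atTop (({s}, n) : Finset S × ℕ)] with i hi
  rw [dist_zero_right]
  refine (h i s (hi.1 (Finset.mem_singleton_self s))).trans (lt_of_le_of_lt ?_ hn)
  exact Nat.one_div_le_one_div hi.2

lemma isUniformlyMeanErgodic_of_fixed {P : E →L[ℂ] E} (hP : P ∈ closedHull T)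
    (h : ∀ s, app T s * P = P) : IsUniformlyMeanErgodic T := by
  have key : ∀ R ∈ closedHull T, R * P = P :=
    fun R hR => closedHull_subset (T := T) (X := {R | R * P = P})
      (isClosed_eq (by fun_prop) continuous_const)
      (fun x hx y hy p q _ _ hpq => by
        simp only [Set.mem_ofPred_eq] at hx hy ⊢
        rw [add_mul, smul_mul_assoc, smul_mul_assoc, hx, hy, ← add_smul, hpq, one_smul]) h hR
  exact ⟨P, hP, fun R hR => ⟨key R hR, by rw [closedHull_comm hP hR, key R hR]⟩⟩

/-- A unitary character lies outside the unitary spectrum if and only if `0` is a limit of convex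
combinations of the operators of the rotated representation. -/
lemma notMem_unitarySpectrum_iff [CompleteSpace E] (hT : IsBoundedRep T) (χ : UnitaryChar S) :
    χ ∉ unitarySpectrum T ↔ 0 ∈ closedHull (twist χ⁻¹ T) := by
  have hχ : ∀ s, charVal χ s • (1 - app (twist χ⁻¹ T) s) =
      algebraMap ℂ (E →L[ℂ] E) (charVal χ s) - app T s := by
    intro s
    rw [app_twist, charVal_inv, smul_sub, smul_smul, mul_inv_cancel₀ (charVal_ne_zero χ s),
      one_smul, Algebra.algebraMap_eq_smul_one]
  rw [unitarySpectrum, Set.mem_ofPred_eq, not_not]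
  set I := Ideal.span (Set.range fun s : S =>
    algebraMap ℂ (E →L[ℂ] E) (charVal χ s) - app T s) with hI
  constructor
  · intro htop
    classical
    obtain ⟨a, ha, hlim⟩ := exists_average_net (hT.twist χ⁻¹)
    have : Tendsto a atTop (𝓝 0) := by
      -- The $x$ with $xa_i\to 0$ form a left ideal containing the generators of $I$; for $x=1$ this
      -- says $a_i\to 0$.
      have h1 : ∀ x ∈ I, Tendsto (fun i => x * a i) atTop (𝓝 0) := by
        intro x hx
        induction hx using Submodule.span_induction with
        | mem x hx =>
          obtain ⟨s, rfl⟩ := hx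
          simp only [← hχ, smul_mul_assoc]
          simpa using (hlim s).const_smul (charVal χ s)
        | zero => simp
        | add x y _ _ hx hy => simpa [add_mul] using hx.add hy
        | smul b x _ hx => simpa [mul_assoc] using hx.const_mul b
      simpa using h1 1 (htop ▸ Submodule.mem_top)
    exact isClosed_closure.mem_of_tendsto this (Eventually.of_forall ha)
  · intro h0
    obtain ⟨a, ha, hna⟩ := Metric.mem_closure_iff.1 h0 1 one_pos
    rw [dist_zero_left] at hna
    -- A convex combination $a$ with $\|a\|<1$ then makes $1-a$ an invertible element of $I$.
    have hsub : convexHull ℝ (Set.range (app (twist χ⁻¹ T))) ⊆ {a | 1 - a ∈ I} := by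
      refine convexHull_min (Set.range_subset_iff.2 fun s => ?_) ?_
      · have : 1 - app (twist χ⁻¹ T) s = algebraMap ℂ (E →L[ℂ] E) (charVal χ s)⁻¹ *
            (algebraMap ℂ (E →L[ℂ] E) (charVal χ s) - app T s) := by
          rw [← hχ, Algebra.algebraMap_eq_smul_one, smul_mul_assoc, one_mul, smul_smul,
            inv_mul_cancel₀ (charVal_ne_zero χ s), one_smul]
        rw [Set.mem_ofPred_eq, this]
        exact I.mul_mem_left _ (Ideal.subset_span ⟨s, rfl⟩)
      · intro x hx y hy p q _ _ hpq
        have : 1 - (p • x + q • y) = algebraMap ℝ (E →L[ℂ] E) p * (1 - x) +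
            algebraMap ℝ (E →L[ℂ] E) q * (1 - y) := by
          rw [Algebra.algebraMap_eq_smul_one, Algebra.algebraMap_eq_smul_one, smul_mul_assoc,
            smul_mul_assoc, one_mul, one_mul, smul_sub, smul_sub]
          nth_rw 1 [← one_smul ℝ (1 : E →L[ℂ] E), ← hpq, add_smul]
          abel
        rw [Set.mem_ofPred_eq, this]
        exact I.add_mem (I.mul_mem_left _ hx) (I.mul_mem_left _ hy)
    exact Ideal.eq_top_of_isUnit_mem I (hsub ha) (isUnit_one_sub_of_norm_lt_one hna)

end ClosedHull

/-! ### Poles and mean ergodicity -/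

section Poles

variable {S : Type u} [AddCommMonoid S] {E : Type v} [NormedAddCommGroup E] [NormedSpace ℂ E]
  {T : Rep S (E →L[ℂ] E)}

lemma app_twist_mul_eq_iff {χ : UnitaryChar S} {s : S} {P : E →L[ℂ] E} :
    app (twist χ⁻¹ T) s * P = P ↔ app T s * P = charVal χ s • P := by
  rw [app_twist, charVal_inv, smul_mul_assoc, inv_smul_eq_iff₀ (charVal_ne_zero χ s)]

lemma commute_of_app_twist {χ : UnitaryChar S} {P : E →L[ℂ] E} {s : S}
    (h : P * app (twist χ T) s = app (twist χ T) s * P) : P * app T s = app T s * P := by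
  rw [app_twist, mul_smul_comm, smul_mul_assoc] at h
  exact smul_right_injective _ (charVal_ne_zero χ s) h

/-- A zero element of the closed convex hull of `χ⁻¹T` is a projection onto `ker(χ - T)` that
commutes with `T`. -/
lemma mean_ergodic_projection {χ : UnitaryChar S} {P : E →L[ℂ] E}
    (hP : P ∈ closedHull (twist χ⁻¹ T)) (h : ∀ s, app (twist χ⁻¹ T) s * P = P) :
    P * P = P ∧ (P : E →ₗ[ℂ] E).range = eigenspace χ T ∧ ∀ s, P * app T s = app T s * P := by
  have hidem : P * P = P := by
    refine closedHull_subset (T := twist χ⁻¹ T) (X := {R | R * P = P})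
      (isClosed_eq (by fun_prop) continuous_const) (fun x hx y hy p q _ _ hpq => ?_) h hP
    simp only [Set.mem_ofPred_eq] at hx hy ⊢
    rw [add_mul, smul_mul_assoc, smul_mul_assoc, hx, hy, ← add_smul, hpq, one_smul]
  refine ⟨hidem, le_antisymm ?_ ?_, fun s => commute_of_app_twist (χ := χ⁻¹)
    (closedHull_comm hP (app_mem_closedHull _ s))⟩
  · rintro _ ⟨x, rfl⟩ s
    exact DFunLike.congr_fun (app_twist_mul_eq_iff.1 (h s)) x
  · intro x hx
    refine ⟨x, ?_⟩
    refine closedHull_subset (T := twist χ⁻¹ T) (X := {R | R x = x})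
      (isClosed_eq (by fun_prop) continuous_const) (fun y hy z hz p q _ _ hpq => ?_) (fun s => ?_) hP
    · simp only [Set.mem_ofPred_eq] at hy hz ⊢
      rw [add_apply, smul_apply,
        smul_apply, hy, hz, ← add_smul, hpq, one_smul]
    · rw [Set.mem_ofPred_eq, app_twist, smul_apply, hx s, charVal_inv,
        smul_smul, inv_mul_cancel₀ (charVal_ne_zero χ s), one_smul]

lemma one_sub_apply_mem_ker {P : E →L[ℂ] E} (h : P * P = P) (x : E) :
    (1 - P) x ∈ (P : E →ₗ[ℂ] E).ker := by
  have := DFunLike.congr_fun h x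
  have h' : P (P x) = P x := this
  simp [h']

/-- The complementary projection of `P`, as an operator onto the kernel of `P`. -/
def kerProj (P : E →L[ℂ] E) (h : P * P = P) : E →L[ℂ] (P : E →ₗ[ℂ] E).ker :=
  (1 - P).codRestrict _ (one_sub_apply_mem_ker h)

lemma isPole_iff [CompleteSpace E] (hT : IsBoundedRep T) (χ : UnitaryChar S) :
    IsPole χ T ↔ IsUniformlyMeanErgodic (twist χ⁻¹ T) := by
  constructor
  · rintro ⟨P, hidem, hrange, hcomm, hinv, hspec⟩
    have : CompleteSpace (P : E →ₗ[ℂ] E).ker := P.isClosed_ker.completeSpace_coe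
    rw [notMem_unitarySpectrum_iff (hT.restrict hinv)] at hspec
    have hfix : ∀ s, app (twist χ⁻¹ T) s * P = P := fun s => by
      rw [app_twist_mul_eq_iff]
      ext x
      exact (hrange ▸ LinearMap.mem_range_self (P : E →ₗ[ℂ] E) x :
        P x ∈ eigenspace χ T) s
    refine isUniformlyMeanErgodic_of_fixed (P := P) ?_ hfix
    set ι := (P : E →ₗ[ℂ] E).ker.subtypeL
    -- The affine map $Y\mapsto P+\iota Y(1-P)$ carries the hull over $\ker P$ into the hull over
    -- $E$, and sends $0$ to $P$.
    have := closedHull_subset (T := twist χ⁻¹ (restrict T _ hinv))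
      (X := {Y | P + ι ∘L Y ∘L kerProj P hidem ∈ closedHull (twist χ⁻¹ T)})
      (isClosed_closure.preimage (by fun_prop)) (fun x hx y hy p q hp hq hpq => ?_)
      (fun s => ?_) hspec
    · simpa using this
    · have := convex_closedHull _ hx hy hp hq hpq
      rw [Set.mem_ofPred_eq]
      convert this using 1
      nth_rw 1 [← one_smul ℝ P, ← hpq]
      ext z
      simp only [add_apply, smul_apply,
        ContinuousLinearMap.comp_apply, map_add, smul_add, add_smul]
      have : ∀ (c : ℝ) (y : (P : E →ₗ[ℂ] E).ker), ι (c • y) = c • ι y := fun _ _ => rfl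
      simp only [this]
      abel
    · have : P + ι ∘L app (twist χ⁻¹ (restrict T _ hinv)) s ∘L kerProj P hidem =
          app (twist χ⁻¹ T) s := by
        have h1 : ι ∘L app (twist χ⁻¹ (restrict T _ hinv)) s ∘L kerProj P hidem =
          app (twist χ⁻¹ T) s * (1 - P) := rfl
        rw [h1, mul_sub, hfix, mul_one]
        abel
      rw [Set.mem_ofPred_eq, this]
      exact app_mem_closedHull _ s
  · rintro ⟨P, hP, hz⟩
    have hfix : ∀ s, app (twist χ⁻¹ T) s * P = P := fun s => (hz _ (app_mem_closedHull _ s)).1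
    obtain ⟨hidem, hrange, hcomm⟩ := mean_ergodic_projection hP hfix
    have hinv : IsInvariant T (P : E →ₗ[ℂ] E).ker := fun s x hx => by
      have h1 := DFunLike.congr_fun (hcomm s) x
      have h2 : P x = 0 := hx
      change P (app T s x) = 0
      simpa [h2] using h1
    refine ⟨P, hidem, hrange, hcomm, hinv, ?_⟩
    have : CompleteSpace (P : E →ₗ[ℂ] E).ker := P.isClosed_ker.completeSpace_coe
    rw [notMem_unitarySpectrum_iff (hT.restrict hinv)]
    set ι := (P : E →ₗ[ℂ] E).ker.subtypeL
    have hπ : ∀ x : (P : E →ₗ[ℂ] E).ker, kerProj P hidem x = x := fun x => by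
      have : P x = 0 := x.2
      ext
      simp [kerProj, this]
    -- Conversely, compression to $\ker P$ carries hull to hull and sends $P$ to $0$.
    have := closedHull_subset (T := twist χ⁻¹ T)
      (X := {Y | kerProj P hidem ∘L Y ∘L ι ∈ closedHull (twist χ⁻¹ (restrict T _ hinv))})
      (isClosed_closure.preimage (by fun_prop)) (fun x hx y hy p q hp hq hpq => ?_)
      (fun s => ?_) hP
    · have h0 : kerProj P hidem ∘L P ∘L ι = 0 := by
        ext x
        have : P x = 0 := x.2
        simp [ι, this]
      rwa [Set.mem_ofPred_eq, h0] at this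
    · have := convex_closedHull _ hx hy hp hq hpq
      rw [Set.mem_ofPred_eq]
      convert this using 1
      ext z
      simp
    · have : kerProj P hidem ∘L app (twist χ⁻¹ T) s ∘L ι =
          app (twist χ⁻¹ (restrict T _ hinv)) s := by
        ext x
        exact congrArg Subtype.val (hπ (app (twist χ⁻¹ (restrict T _ hinv)) s x))
      rw [Set.mem_ofPred_eq, this]
      exact app_mem_closedHull _ s

/-- Characters outside the spectrum cost nothing: there $0$ itself is the zero element of the hull.
-/
lemma forall_isPole_iff [CompleteSpace E] (hT : IsBoundedRep T) :
    (∀ χ ∈ unitarySpectrum T, IsPole χ T) ↔ IsTotallyUniformlyMeanErgodic T := by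
  constructor
  · intro h χ
    rw [← inv_inv χ]
    by_cases hχ : χ⁻¹ ∈ unitarySpectrum T
    · exact (isPole_iff hT _).1 (h _ hχ)
    · exact isUniformlyMeanErgodic_of_fixed ((notMem_unitarySpectrum_iff hT _).1 hχ) (by simp)
  · exact fun h χ _ => (isPole_iff hT χ).2 (h _)

end Poles

/-! ### Compactness at infinity -/

section Compactness

variable {S : Type u} [AddCommMonoid S] {E : Type v} [NormedAddCommGroup E] [NormedSpace ℂ E]
  {T : Rep S (E →L[ℂ] E)}

/-- The net `(T_s)` converges along every ultrafilter finer than its filter at infinity. -/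
def ConvergesAlongUltrafilters (T : Rep S (E →L[ℂ] E)) : Prop :=
  ∀ U : Ultrafilter S, (U : Filter S) ≤ atInfty S → ∃ L, Tendsto (app T) U (𝓝 L)

/-- Nearest points in the compact set $\overline C$ converge along the ultrafilter, and $T_s$
follows them. -/
lemma IsNormConstrictive.convergesAlongUltrafilters (h : IsNormConstrictive T) :
    ConvergesAlongUltrafilters T := by
  obtain ⟨C, hne, hC, hlim⟩ := h
  intro U hU
  choose c hc hdist using fun s => hC.exists_infDist_eq_dist hne.closure (app T s)
  obtain ⟨L, -, hL⟩ := hC.ultrafilter_le_nhds (U.map c)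
    (le_principal_iff.2 (Eventually.of_forall hc : ∀ᶠ s in (U : Filter S), c s ∈ closure C))
  refine ⟨L, tendsto_iff_dist_tendsto_zero.2 ?_⟩
  have h1 : Tendsto (fun s => dist (app T s) (c s)) U (𝓝 0) := by
    simpa only [← hdist, Metric.infDist_closure] using hlim.mono_left hU
  have h2 : Tendsto (fun s => dist (c s) L) U (𝓝 0) := tendsto_iff_dist_tendsto_zero.1 hL
  exact squeeze_zero (fun _ => dist_nonneg) (fun s => dist_triangle _ (c s) _)
    (by simpa using h1.add h2)

lemma ConvergesAlongUltrafilters.everySubnetHasConvergentSubnet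
    (h : ConvergesAlongUltrafilters T) : EverySubnetHasConvergentSubnet.{u, v, w} T := by
  intro J _ _ _ φ hφ
  obtain ⟨L, hL⟩ := h ((Ultrafilter.of atTop).map φ) (hφ.mono_left (Ultrafilter.of_le _))
  replace hL : Tendsto (fun j => app T (φ j)) (Ultrafilter.of (atTop : Filter J)) (𝓝 L) := hL
  have hex : ∀ (j : J) (n : ℕ), ∃ i, j ≤ i ∧ dist (app T (φ i)) L < 1 / ((n : ℝ) + 1) := by
    intro j n
    have h1 : ∀ᶠ i in (Ultrafilter.of (atTop : Filter J) : Filter J), j ≤ i :=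
      (Ultrafilter.of_le _) (Ici_mem_atTop j)
    exact (h1.and (Metric.tendsto_nhds.1 hL _ Nat.one_div_pos_of_nat)).exists
  -- The second coordinate records the required accuracy, so convergence to $L$ is built into the
  -- index set.
  let K := {p : J × ℕ // dist (app T (φ p.1)) L < 1 / ((p.2 : ℝ) + 1)}
  have hK : ∀ (j : J) (n : ℕ), ∃ k : K, j ≤ k.1.1 ∧ n ≤ k.1.2 := fun j n => by
    obtain ⟨i, hi, hd⟩ := hex j n
    exact ⟨⟨(i, n), hd⟩, hi, le_rfl⟩
  have hdir : IsDirectedOrder K := ⟨fun a b => by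
    obtain ⟨j, hj₁, hj₂⟩ := exists_ge_ge a.1.1 b.1.1
    obtain ⟨k, hk₁, hk₂⟩ := hK j (max a.1.2 b.1.2)
    exact ⟨k, ⟨hj₁.trans hk₁, (le_max_left _ _).trans hk₂⟩,
      ⟨hj₂.trans hk₁, (le_max_right _ _).trans hk₂⟩⟩⟩
  have hne : Nonempty K := ⟨(hK (Classical.arbitrary J) 0).choose⟩
  refine ⟨K, inferInstance, hdir, hne, fun k => k.1.1, ?_, L, ?_⟩
  · refine tendsto_atTop.2 fun j => ?_
    obtain ⟨k, hk, -⟩ := hK j 0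
    filter_upwards [Ici_mem_atTop k] with i hi using hk.trans hi.1
  · refine Metric.tendsto_nhds.2 fun ε hε => ?_
    obtain ⟨n, hn⟩ := exists_nat_one_div_lt hε
    obtain ⟨k, -, hk⟩ := hK (Classical.arbitrary J) n
    filter_upwards [Ici_mem_atTop k] with i hi
    exact i.2.trans_le ((Nat.one_div_le_one_div (hk.trans hi.2)).trans hn.le)

lemma EverySubnetHasConvergentSubnet.convergesAlongUltrafilters
    (h : EverySubnetHasConvergentSubnet.{u, v, w} T) : ConvergesAlongUltrafilters T := by
  intro U hU
  -- Pointed members of $U$, ordered by reverse inclusion of the sets alone: the canonical net of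
  -- the ultrafilter.
  let J₀ := {p : S × (Set S)ᵒᵈ // p.1 ∈ OrderDual.ofDual p.2 ∧ OrderDual.ofDual p.2 ∈ U}
  let _ : Preorder J₀ := Preorder.lift fun p : J₀ => p.1.2
  have hJ : ∀ X ∈ U, ∃ p : J₀, p.1.2 = OrderDual.toDual X := fun X hX => by
    obtain ⟨x, hx⟩ := U.nonempty_of_mem hX
    exact ⟨⟨(x, OrderDual.toDual X), hx, hX⟩, rfl⟩
  have _ : IsDirectedOrder J₀ := ⟨fun a b => by
    obtain ⟨p, hp⟩ := hJ _ (inter_mem a.2.2 b.2.2)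
    refine ⟨p, ?_, ?_⟩
    · change a.1.2 ≤ p.1.2
      rw [hp]
      exact Set.inter_subset_left
    · change b.1.2 ≤ p.1.2
      rw [hp]
      exact Set.inter_subset_right⟩
  have _ : Nonempty J₀ := ⟨(hJ Set.univ univ_mem).choose⟩
  let J := ULift.{max u w} J₀
  let _ : Preorder J := Preorder.lift ULift.down
  have _ : IsDirectedOrder J := ⟨fun a b => by
    obtain ⟨c, hac, hbc⟩ := exists_ge_ge a.down b.down
    exact ⟨⟨c⟩, hac, hbc⟩⟩
  let φ : J → S := fun p => p.down.1.1
  have hφ : Tendsto φ atTop (U : Filter S) := fun X hX => by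
    obtain ⟨p, hp⟩ := hJ X hX
    refine mem_map.2 (mem_of_superset (Ici_mem_atTop (⟨p⟩ : J)) fun i hi => ?_)
    have h1 : p.1.2 ≤ i.down.1.2 := hi
    rw [hp] at h1
    exact h1 i.down.2.1
  obtain ⟨K, _, _, _, k, hk, L, hL⟩ := h J φ (hφ.mono_right hU)
  refine ⟨L, ?_⟩
  -- An ultrafilter has no strictly finer proper filter, so the subnet still generates all of $U$.
  have hU' : map (φ ∘ k) atTop = (U : Filter S) := U.unique (hφ.comp hk)
  rw [← hU']
  exact tendsto_map'_iff.2 hL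

lemma mem_semigroupAtInfinity_iff {L : E →L[ℂ] E} :
    L ∈ semigroupAtInfinity T ↔ MapClusterPt L (atInfty S) (app T) := by
  rw [mapClusterPt_iff_frequently, semigroupAtInfinity, Set.mem_iInter]
  constructor
  · intro h X hX hev
    obtain ⟨s₀, hs₀⟩ := mem_atInfty_iff.1 hev
    obtain ⟨_, hx, s, ⟨r, rfl⟩, rfl⟩ := mem_closure_iff_nhds.1 (h s₀) X hX
    exact hs₀ r hx
  · intro h s₀
    refine mem_closure_iff_nhds.2 fun X hX => ?_
    obtain ⟨s, hs, hs₀⟩ := ((h X hX).and_eventually (setOf_le_mem_atInfty s₀)).exists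
    exact ⟨_, hs, s, hs₀, rfl⟩

lemma ConvergesAlongUltrafilters.nonempty_semigroupAtInfinity
    (h : ConvergesAlongUltrafilters T) : (semigroupAtInfinity T).Nonempty := by
  obtain ⟨L, hL⟩ := h (Ultrafilter.of (atInfty S)) (Ultrafilter.of_le _)
  exact ⟨L, mem_semigroupAtInfinity_iff.2 (hL.mapClusterPt.mono (Ultrafilter.of_le _))⟩

lemma ConvergesAlongUltrafilters.isCompact_semigroupAtInfinity
    (h : ConvergesAlongUltrafilters T) : IsCompact (semigroupAtInfinity T) := by
  refine IsSeqCompact.isCompact fun R hR => ?_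
  -- Diagonal argument: couple each $R_n$ with operators $T_s$ within $1/(n+1)$ arbitrarily far out.
  -- A limit of $T_s$ along an ultrafilter finer than $G$ is then a cluster point of both $(T_s)$
  -- and $(R_n)$.
  let G : Filter (S × ℕ) := (atInfty S ×ˢ atTop) ⊓
    𝓟 {p | dist (app T p.1) (R p.2) < 1 / ((p.2 : ℝ) + 1)}
  have hG : G.NeBot := by
    refine inf_principal_neBot_iff.2 fun V hV => ?_
    obtain ⟨X, hX, Y, hY, hXY⟩ := mem_prod_iff.1 hV
    obtain ⟨n, hn⟩ := nonempty_of_mem hY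
    obtain ⟨s, hs, hsX⟩ := ((mapClusterPt_iff_frequently.1
      (mem_semigroupAtInfinity_iff.1 (hR n)) _
        (Metric.ball_mem_nhds _ (Nat.one_div_pos_of_nat (n := n)))).and_eventually hX).exists
    exact ⟨(s, n), hXY ⟨hsX, hn⟩, hs⟩
  let W := Ultrafilter.of G
  have hW : (W : Filter (S × ℕ)) ≤ G := (Ultrafilter.of_le _)
  have hfst : Tendsto Prod.fst (W : Filter (S × ℕ)) (atInfty S) :=
    tendsto_fst.mono_left (hW.trans inf_le_left)
  have hsnd : Tendsto Prod.snd (W : Filter (S × ℕ)) atTop :=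
    tendsto_snd.mono_left (hW.trans inf_le_left)
  obtain ⟨L, hL⟩ := h (W.map Prod.fst) hfst
  replace hL : Tendsto (fun p : S × ℕ => app T p.1) W (𝓝 L) := hL
  have hdist : Tendsto (fun p : S × ℕ => dist (app T p.1) (R p.2)) W (𝓝 0) := by
    refine squeeze_zero' (Eventually.of_forall fun _ => dist_nonneg) ?_
      (tendsto_one_div_add_atTop_nhds_zero_nat.comp hsnd)
    filter_upwards [hW (mem_inf_of_right (mem_principal_self _))] with p hp using hp.le
  have hRL : Tendsto (fun p : S × ℕ => R p.2) W (𝓝 L) :=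
    (tendsto_iff_of_dist hdist).1 hL
  have hcl : MapClusterPt L atTop R := by
    have : MapClusterPt L (map Prod.snd (W : Filter (S × ℕ))) R :=
      Tendsto.mapClusterPt (tendsto_map'_iff.2 hRL)
    exact this.mono hsnd
  refine ⟨L, mem_semigroupAtInfinity_iff.2 (hL.mapClusterPt.of_comp hfst), ?_⟩
  exact hcl.tendsto_subseq

lemma isSemigroupIdeal_semigroupAtInfinity (h : (semigroupAtInfinity T).Nonempty) :
    IsSemigroupIdeal (closure (Set.range (app T))) (semigroupAtInfinity T) := by
  refine ⟨fun L hL => closure_mono (Set.image_subset_range _ _) (Set.mem_iInter.1 hL 0), h, ?_⟩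
  intro c hc d hd
  refine Set.mem_iInter.2 fun s₀ => ?_
  refine map_mem_closure₂ continuous_mul hc (Set.mem_iInter.1 hd s₀) ?_
  rintro _ ⟨t, rfl⟩ _ ⟨_, ⟨r, rfl⟩, rfl⟩
  exact ⟨t + (s₀ + r), ⟨t + r, by abel⟩, app_add _ _ _⟩

/-- A compact semigroup contains an idempotent $P$. Since $P(1-P)=0$, one has
$T_{s_0+r}-T_{s_0+r}P=T_r(T_{s_0}-P)(1-P)$, which is small uniformly in $r$, while $T_{s_0+r}P\in
I$. -/
lemma IsSemigroupIdeal.isNormConstrictive (hT : IsBoundedRep T) {I : Set (E →L[ℂ] E)}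
    (hI : IsSemigroupIdeal (closure (Set.range (app T))) I) (hc : IsCompact I) :
    IsNormConstrictive T := by
  obtain ⟨hsub, hne, hmul⟩ := hI
  obtain ⟨P, hP, hidem⟩ := exists_idempotent_in_compact_subsemigroup
    (fun r => by fun_prop) I hne hc fun x hx y hy => hmul x (hsub hx) y hy
  obtain ⟨M, hM⟩ := hT
  have hM0 : 0 ≤ M := (norm_nonneg _).trans (hM 0)
  refine ⟨I, hne, by rwa [hc.isClosed.closure_eq], Metric.tendsto_nhds.2 fun ε hε => ?_⟩
  have hcl : P ∈ closure (Set.range (app T)) := hsub hP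
  obtain ⟨_, ⟨s₀, rfl⟩, hs₀⟩ := Metric.mem_closure_iff.1 hcl (ε / ((M + 1) * (‖1 - P‖ + 1)))
    (by positivity)
  refine mem_atInfty_iff.2 ⟨s₀, fun r => ?_⟩
  rw [Set.mem_ofPred_eq, Real.dist_0_eq_abs, abs_of_nonneg Metric.infDist_nonneg]
  have hmem : app T (s₀ + r) * P ∈ I := hmul _ (subset_closure ⟨_, rfl⟩) _ hP
  refine (Metric.infDist_le_dist_of_mem hmem).trans_lt ?_
  rw [dist_eq_norm] at hs₀ ⊢
  have heq : app T (s₀ + r) - app T (s₀ + r) * P = app T r * ((app T s₀ - P) * (1 - P)) := by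
    have : P * (1 - P) = 0 := by rw [mul_sub, mul_one, hidem, sub_self]
    rw [sub_mul, this, sub_zero, ← mul_assoc, ← app_add, add_comm, mul_sub, mul_one]
  rw [heq]
  have hs₁ : ‖app T s₀ - P‖ < ε / ((M + 1) * (‖1 - P‖ + 1)) := by rwa [norm_sub_rev]
  calc ‖app T r * ((app T s₀ - P) * (1 - P))‖
      ≤ ‖app T r‖ * (‖app T s₀ - P‖ * ‖1 - P‖) :=
        (norm_mul_le _ _).trans (mul_le_mul_of_nonneg_left (norm_mul_le _ _) (norm_nonneg _))
    _ ≤ M * (‖app T s₀ - P‖ * (‖1 - P‖ + 1)) := by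
        gcongr
        · exact hM r
        · linarith
    _ ≤ (M + 1) * (‖1 - P‖ + 1) * ‖app T s₀ - P‖ := by
        nlinarith [mul_nonneg (norm_nonneg (app T s₀ - P)) (norm_nonneg (1 - P)),
          norm_nonneg (app T s₀ - P)]
    _ < ε := by
        rw [lt_div_iff₀ (by positivity)] at hs₁
        linarith

lemma ConvergesAlongUltrafilters.twist (h : ConvergesAlongUltrafilters T) (χ : UnitaryChar S) :
    ConvergesAlongUltrafilters (twist χ T) := by
  intro U hU
  obtain ⟨L, hL⟩ := h U hU
  obtain ⟨z, -, hz⟩ := isCompact_univ.ultrafilter_le_nhds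
    (U.map fun s : S => χ (Multiplicative.ofAdd s)) (by simp)
  have hz' : Tendsto (fun s : S => charVal χ s) U (𝓝 (z : ℂ)) :=
    (Continuous.tendsto (by fun_prop : Continuous fun z : Circle => (z : ℂ)) z).comp hz
  exact ⟨_, hz'.smul hL⟩

lemma ConvergesAlongUltrafilters.isUniformlyMeanErgodic [CompleteSpace E]
    (h : ConvergesAlongUltrafilters T) (hT : IsBoundedRep T) : IsUniformlyMeanErgodic T := by
  classical
  set X := semigroupAtInfinity T
  have hideal := isSemigroupIdeal_semigroupAtInfinity h.nonempty_semigroupAtInfinity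
  obtain ⟨R, hR⟩ := h.nonempty_semigroupAtInfinity
  set K := closure (convexHull ℝ X)
  have hK : IsCompact K :=
    TotallyBounded.isCompact_of_isClosed
      (totallyBounded_convexHull.2 h.isCompact_semigroupAtInfinity.totallyBounded).closure
      isClosed_closure
  have hKsub : K ⊆ closedHull T :=
    closure_minimal (convexHull_min (hideal.1.trans (closure_mono (subset_convexHull ℝ _)))
      (convex_closedHull T)) isClosed_closure
  obtain ⟨a, ha, hlim⟩ := exists_average_net hT
  -- The ideal property of $\mathscr T_\infty$ passes to convex combinations and limits, so
  -- multiplication by $R$ moves the averages into a compact set.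
  have haK : ∀ i, a i * R ∈ K := fun i =>
    closedHull_subset (T := T) (X := {b | b * R ∈ K}) (isClosed_closure.preimage (by fun_prop))
      (fun x hx y hy p q hp hq hpq => by
        simpa [add_mul] using (convex_convexHull ℝ X).closure hx hy hp hq hpq)
      (fun s => subset_closure (subset_convexHull ℝ _
        (hideal.2.2 _ (subset_closure ⟨s, rfl⟩) _ hR))) (ha i)
  let U : Ultrafilter (Finset S × ℕ) := Ultrafilter.of atTop
  obtain ⟨P, hPK, hP⟩ := hK.ultrafilter_le_nhds (U.map fun i => a i * R)
    (le_principal_iff.2 (Eventually.of_forall haK : ∀ᶠ i in (U : Filter _), a i * R ∈ K))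
  replace hP : Tendsto (fun i => a i * R) U (𝓝 P) := hP
  refine isUniformlyMeanErgodic_of_fixed (hKsub hPK) fun s => ?_
  have h1 : Tendsto (fun i => (1 - app T s) * (a i * R)) U (𝓝 0) := by
    simpa [mul_assoc] using ((hlim s).mono_left (Ultrafilter.of_le _)).mul_const R
  have h3 : (1 - app T s) * P = 0 := tendsto_nhds_unique (hP.const_mul _) h1
  rw [sub_mul, one_mul, sub_eq_zero] at h3
  exact h3.symm

end Compactness

/-! ### Gelfand theory and uniform stability -/

section Gelfand

open WeakDual

/-- The powers of an element of spectral radius less than one tend to zero. -/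
lemma tendsto_pow_of_spectralRadius_lt_one {B : Type v} [NormedRing B] [NormedAlgebra ℂ B]
    [CompleteSpace B] {a : B} (ha : spectralRadius ℂ a < 1) :
    Tendsto (fun n => a ^ n) atTop (𝓝 0) := by
  obtain ⟨c, hac, hc⟩ := ENNReal.lt_iff_exists_nnreal_btwn.1 ha
  have hev := (spectrum.pow_nnnorm_pow_one_div_tendsto_nhds_spectralRadius a).eventually
    (gt_mem_nhds hac)
  have hc' : (c : ℝ) < 1 := by exact_mod_cast hc
  refine squeeze_zero_norm' ?_ (tendsto_pow_atTop_nhds_zero_of_lt_one c.2 hc')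
  filter_upwards [hev, eventually_ne_atTop 0] with n hn hn0
  have h1 : (‖a ^ n‖₊ : ENNReal) ≤ (c : ENNReal) ^ n := by
    rw [← ENNReal.rpow_inv_natCast_pow hn0 (‖a ^ n‖₊ : ENNReal), ← one_div]
    exact pow_le_pow_left₀ zero_le hn.le n
  exact_mod_cast h1

variable {S : Type u} [AddCommMonoid S] {B : Type v} [NormedCommRing B] [NormedAlgebra ℂ B]
  [CompleteSpace B] {T : Rep S B}

/-- Otherwise $\varphi(T_{ns})=\varphi(T_s)^n$ would be unbounded in $n$. -/
lemma norm_character_app_le_one (hT : IsBoundedRep T) (φ : characterSpace ℂ B) (s : S) :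
    ‖φ (app T s)‖ ≤ 1 := by
  by_contra! h
  obtain ⟨M, hM⟩ := hT
  obtain ⟨n, hn⟩ := ((tendsto_pow_atTop_atTop_of_one_lt h).eventually_gt_atTop
    (M * ‖(1 : B)‖)).exists
  have h1 : ‖φ (app T (n • s))‖ ≤ ‖app T (n • s)‖ * ‖(1 : B)‖ :=
    AlgHom.norm_apply_le_self_mul_norm_one (CharacterSpace.toAlgHom φ) (app T (n • s))
  rw [app_nsmul, map_pow, norm_pow, ← app_nsmul] at h1
  exact absurd (hn.trans_le (h1.trans (mul_le_mul_of_nonneg_right (hM _) (norm_nonneg _))))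
    (lt_irrefl _)

/-- The unitary character `s ↦ φ(T_s)` obtained from a character `φ` that is unimodular on
`T(S)`. -/
noncomputable def unitaryCharOfCharacter (T : Rep S B) (φ : characterSpace ℂ B)
    (h : ∀ s, ‖φ (app T s)‖ = 1) : UnitaryChar S where
  toFun s := ⟨φ (T s), mem_sphere_zero_iff_norm.2 (h s.toAdd)⟩
  map_one' := by
    ext
    simp
  map_mul' s t := by
    refine Circle.ext ?_
    change φ (T (s * t)) = φ (T s) * φ (T t)
    rw [map_mul, map_mul]

lemma mul_eq_zero_of_ne {A : Type v} [Ring A] [Algebra ℂ A] {T : Rep S A}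
    {χ ψ : UnitaryChar S} (hne : χ ≠ ψ) {p q : A} (hp : ∀ s, app T s * p = charVal χ s • p)
    (hq : ∀ s, app T s * q = charVal ψ s • q) (hcomm : ∀ s, p * app T s = app T s * p) :
    p * q = 0 := by
  obtain ⟨s, hs⟩ : ∃ s, charVal χ s ≠ charVal ψ s := by
    by_contra! h
    exact hne (charVal_injective h)
  have h1 : charVal χ s • (p * q) = charVal ψ s • (p * q) := by
    rw [← smul_mul_assoc, ← hp, ← mul_smul_comm, ← hq, ← mul_assoc, hcomm]
  rw [← sub_eq_zero, ← sub_smul] at h1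
  exact (smul_eq_zero.1 h1).resolve_left (sub_ne_zero.2 hs)

/-- If `T_{n s₀} q` tends to zero as `n → ∞` then so does `T_s q` along the net. -/
lemma tendsto_app_mul_of_tendsto_pow {A : Type v} [NormedRing A] {T : Rep S A}
    (hT : IsBoundedRep T) {q : A} {s₀ : S}
    (h : Tendsto (fun n : ℕ => app T (n • s₀) * q) atTop (𝓝 0)) :
    Tendsto (fun s => app T s * q) (atInfty S) (𝓝 0) := by
  obtain ⟨M, hM⟩ := hT
  have hM0 : 0 ≤ M := (norm_nonneg _).trans (hM 0)
  refine Metric.tendsto_nhds.2 fun ε hε => ?_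
  obtain ⟨n, hn⟩ := (Metric.tendsto_nhds.1 h (ε / (M + 1)) (by positivity)).exists
  rw [dist_zero_right, lt_div_iff₀ (by positivity)] at hn
  refine mem_atInfty_iff.2 ⟨n • s₀, fun r => ?_⟩
  rw [Set.mem_ofPred_eq, dist_zero_right, add_comm, app_add, mul_assoc]
  calc ‖app T r * (app T (n • s₀) * q)‖ ≤ M * ‖app T (n • s₀) * q‖ :=
        (norm_mul_le _ _).trans (mul_le_mul_of_nonneg_right (hM r) (norm_nonneg _))
    _ < ε := by nlinarith [norm_nonneg (app T (n • s₀) * q)]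

/-- If every unitary character arising from the Gelfand space is separated off by an idempotent,
then finitely many of these idempotents suffice to make the remaining part of the representation
uniformly stable. -/
lemma exists_finset_tendsto_zero (hT : IsBoundedRep T) (p : UnitaryChar S → B)
    (hp : ∀ χ s, app T s * p χ = charVal χ s • p χ) (hidem : ∀ χ, p χ * p χ = p χ)
    (hφ : ∀ χ (φ : characterSpace ℂ B), (∀ s, φ (app T s) = charVal χ s) → φ (p χ) = 1) :
    ∃ F : Finset (UnitaryChar S),
      Tendsto (fun s => app T s * (1 - ∑ χ ∈ F, p χ)) (atInfty S) (𝓝 0) := by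
  classical
  rcases subsingleton_or_nontrivial B with hB | hB
  · exact ⟨∅, tendsto_const_nhds.congr fun _ => Subsingleton.elim _ _⟩
  -- These open sets cover: a character $\varphi$ of modulus one on all of $T(S)$ restricts to a
  -- unitary $\chi$, and then $\varphi(p_\chi)=1$.
  let U : UnitaryChar S ⊕ S → Set (characterSpace ℂ B) :=
    Sum.elim (fun χ => {φ | φ (p χ) ≠ 0}) (fun s => {φ | ‖φ (app T s)‖ < 1})
  have hev : ∀ b : B, Continuous fun φ : characterSpace ℂ B => φ b := fun b =>
    (WeakDual.eval_continuous b).comp continuous_subtype_val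
  have hU : ∀ i, IsOpen (U i) := by
    rintro (χ | s)
    · exact isOpen_ne_fun (hev _) continuous_const
    · exact isOpen_lt (hev _).norm continuous_const
  have hcover : (Set.univ : Set (characterSpace ℂ B)) ⊆ ⋃ i, U i := by
    intro φ _
    by_contra hnot
    simp only [Set.mem_iUnion, not_exists] at hnot
    have h1 : ∀ s, ‖φ (app T s)‖ = 1 := fun s =>
      le_antisymm (norm_character_app_le_one hT φ s) (not_lt.1 (hnot (Sum.inr s)))
    refine hnot (Sum.inl (unitaryCharOfCharacter T φ h1)) ?_
    change φ (p _) ≠ 0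
    rw [hφ _ φ fun s => rfl]
    exact one_ne_zero
  obtain ⟨t, ht⟩ := isCompact_univ.elim_finite_subcover U hU hcover
  set F := t.toLeft
  -- Summing makes $\varphi(T_{s_0})$ the product of all $\varphi(T_s)$ in the subcover, so one
  -- contractive factor suffices.
  set s₀ := ∑ s ∈ t.toRight, s
  set q := 1 - ∑ χ ∈ F, p χ with hq
  have hpq : ∀ χ ∈ F, q * p χ = 0 := by
    intro χ hχ
    rw [hq, sub_mul, one_mul, Finset.sum_mul, Finset.sum_eq_single χ, hidem, sub_self]
    · exact fun ψ _ hne => mul_eq_zero_of_ne hne (hp ψ) (hp χ) fun s => mul_comm _ _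
    · exact fun h => absurd hχ h
  have hqq : q * q = q := by
    nth_rw 2 [hq]
    rw [mul_sub, mul_one, Finset.mul_sum, Finset.sum_eq_zero hpq, sub_zero]
  refine ⟨F, tendsto_app_mul_of_tendsto_pow hT (s₀ := s₀) ?_⟩
  have hpow : (fun n : ℕ => (app T s₀ * q) ^ n) =ᶠ[atTop] fun n => app T (n • s₀) * q := by
    filter_upwards [eventually_ne_atTop 0] with n hn
    rw [mul_pow, app_nsmul, IsIdempotentElem.pow_eq hqq hn]
  refine (tendsto_pow_of_spectralRadius_lt_one ?_).congr' hpow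
  refine spectrum.spectralRadius_lt_of_forall_lt (r := 1) _ fun z hz => ?_
  obtain ⟨φ, rfl⟩ := CharacterSpace.mem_spectrum_iff_exists.1 hz
  rw [← NNReal.coe_lt_coe, coe_nnnorm, NNReal.coe_one, map_mul, norm_mul]
  obtain ⟨i, hi, hiU⟩ := Set.mem_iUnion₂.1 (ht (Set.mem_univ φ))
  -- Either $\varphi(q)=0$, because $qp_\chi=0$, or $\varphi(q)=1$ and $\varphi$ is covered by a set
  -- of the second kind.
  by_cases hF : ∃ χ ∈ F, φ (p χ) ≠ 0
  · obtain ⟨χ, hχ, hne⟩ := hF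
    have h1 : φ q * φ (p χ) = 0 := by rw [← map_mul, hpq χ hχ, map_zero]
    simp [(mul_eq_zero.1 h1).resolve_right hne]
  · push Not at hF
    have h1 : φ q = 1 := by
      rw [hq, map_sub, map_one, map_sum, Finset.sum_eq_zero hF, sub_zero]
    rw [h1, norm_one, mul_one, app_sum, map_prod, norm_prod]
    rcases i with χ | s
    · exact absurd (hF χ (Finset.mem_toLeft.2 hi)) hiU
    · have hs : s ∈ t.toRight := Finset.mem_toRight.2 hi
      rw [← Finset.mul_prod_erase _ _ hs]
      refine lt_of_le_of_lt (mul_le_of_le_one_right (norm_nonneg _) ?_) hiU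
      exact Finset.prod_le_one (fun _ _ => norm_nonneg _)
        fun r _ => norm_character_app_le_one hT φ r

end Gelfand

/-! ### The spectral decomposition -/

section Decomposition

variable {S : Type u} [AddCommMonoid S] {E : Type v} [NormedAddCommGroup E] [NormedSpace ℂ E]
  {T : Rep S (E →L[ℂ] E)}

/-- Projections for distinct characters annihilate each other, so $P=\sum_{\chi\in F}p_\chi$ is a
projection onto the sum of the eigenspaces; on $\ker P$ the operators $T_s$ and $T_s(1-P)$ agree. -/
lemma hasSpectralDecomposition_of_projections (p : UnitaryChar S → E →L[ℂ] E)
    (hidem : ∀ χ, p χ * p χ = p χ) (hrange : ∀ χ, (p χ : E →ₗ[ℂ] E).range = eigenspace χ T)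
    (hcomm : ∀ χ s, p χ * app T s = app T s * p χ) (F : Finset (UnitaryChar S))
    (hlim : Tendsto (fun s => app T s * (1 - ∑ χ ∈ F, p χ)) (atInfty S) (𝓝 0)) :
    HasSpectralDecomposition T := by
  classical
  have hfix : ∀ χ s, app T s * p χ = charVal χ s • p χ := fun χ s => by
    ext x
    exact (hrange χ ▸ LinearMap.mem_range_self (p χ : E →ₗ[ℂ] E) x :
      p χ x ∈ eigenspace χ T) s
  have horth : ∀ χ ψ, χ ≠ ψ → p χ * p ψ = 0 := fun χ ψ hne =>
    mul_eq_zero_of_ne hne (hfix χ) (hfix ψ) (hcomm χ)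
  have happly : ∀ χ, ∀ x ∈ eigenspace χ T, p χ x = x := by
    intro χ x hx
    rw [← hrange] at hx
    obtain ⟨y, rfl⟩ := hx
    exact DFunLike.congr_fun (hidem χ) y
  have happly0 : ∀ χ ψ, χ ≠ ψ → ∀ x ∈ eigenspace ψ T, p χ x = 0 := by
    intro χ ψ hne x hx
    rw [← happly ψ x hx]
    exact DFunLike.congr_fun (horth χ ψ hne) x
  set P := ∑ χ ∈ F, p χ with hP
  have hPp : ∀ χ ∈ F, P * p χ = p χ := by
    intro χ hχ
    rw [hP, Finset.sum_mul, Finset.sum_eq_single χ, hidem]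
    · exact fun ψ _ hne => horth ψ χ hne
    · exact fun h => absurd hχ h
  have hPP : P * P = P := by
    nth_rw 2 [hP]
    rw [Finset.mul_sum, Finset.sum_congr rfl hPp]
  have hPT : ∀ s, P * app T s = app T s * P := fun s => by
    rw [hP, Finset.sum_mul, Finset.mul_sum, Finset.sum_congr rfl fun χ _ => hcomm χ s]
  have hPPx : ∀ x, P (P x) = P x := fun x => DFunLike.congr_fun hPP x
  have hPTx : ∀ s x, P (app T s x) = app T s (P x) := fun s x => DFunLike.congr_fun (hPT s) x
  have hmem : ∀ x, x ∈ (P : E →ₗ[ℂ] E).range ↔ P x = x := fun x =>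
    ⟨by rintro ⟨y, rfl⟩; exact hPPx y, fun h => ⟨x, h⟩⟩
  have hinvs : IsInvariant T (P : E →ₗ[ℂ] E).ker := fun s x hx => by
    have hx' : P x = 0 := hx
    change P (app T s x) = 0
    rw [hPTx, hx', map_zero]
  refine ⟨(P : E →ₗ[ℂ] E).range, (P : E →ₗ[ℂ] E).ker, ?_, P.isClosed_ker, ?_, ?_,
    ⟨F.card, fun k => (F.equivFin.symm k : UnitaryChar S), ?_, ?_⟩, hinvs, ?_⟩
  · have : ((P : E →ₗ[ℂ] E).range : Set E) = {x | P x = x} := Set.ext hmem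
    rw [this]
    exact isClosed_eq P.continuous continuous_id
  · refine ⟨Submodule.disjoint_def.2 fun x hx hx0 => ?_, codisjoint_iff.2 (eq_top_iff.2 ?_)⟩
    · rw [← (hmem x).1 hx]
      exact hx0
    · intro x _
      refine Submodule.mem_sup.2 ⟨P x, ⟨x, rfl⟩, x - P x, ?_, add_sub_cancel _ _⟩
      change P (x - P x) = 0
      rw [map_sub, hPPx, sub_self]
  · intro s x hx
    rw [hmem] at hx ⊢
    rw [hPTx, hx]
  · rw [iSupIndep_iff_finsetSum_eq_zero_imp_eq_zero]
    intro s x hx h0 i hi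
    have h1 := congrArg (p (F.equivFin.symm i : UnitaryChar S)) h0
    rw [map_sum, map_zero, Finset.sum_eq_single i, happly _ _ (hx i hi)] at h1
    · exact h1
    · intro j hj hne
      refine happly0 _ _ (fun h => hne ?_) _ (hx j hj)
      exact (F.equivFin.symm.injective (Subtype.ext h)).symm
    · exact fun h => absurd hi h
  · refine le_antisymm ?_ (iSup_le fun k x hx => ?_)
    · rintro _ ⟨x, rfl⟩
      change P x ∈ _
      rw [hP, sum_apply]
      refine Submodule.sum_mem _ fun χ hχ => ?_
      refine Submodule.mem_iSup_of_mem (F.equivFin ⟨χ, hχ⟩) ?_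
      beta_reduce
      rw [Equiv.symm_apply_apply, ← hrange]
      exact ⟨x, rfl⟩
    · rw [hmem, ← happly _ x hx]
      exact DFunLike.congr_fun (hPp _ (F.equivFin.symm k).2) x
  · refine squeeze_zero_norm (E := (P : E →ₗ[ℂ] E).ker →L[ℂ] (P : E →ₗ[ℂ] E).ker) (fun s => ?_) (tendsto_zero_iff_norm_tendsto_zero.1 hlim)
    refine ContinuousLinearMap.opNorm_le_bound _ (norm_nonneg _) fun x => ?_
    have hx : P (x : E) = 0 := x.2
    have h1 : ((app (restrict T _ hinvs) s x : (P : E →ₗ[ℂ] E).ker) : E) =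
        (app T s * (1 - P)) (x : E) := by
      change app T s (x : E) = app T s ((x : E) - P x)
      rw [hx, sub_zero]
    have h2 := (app T s * (1 - P)).le_opNorm (x : E)
    rw [← h1] at h2
    exact h2

lemma IsTotallyUniformlyMeanErgodic.hasSpectralDecomposition [CompleteSpace E]
    (hT : IsBoundedRep T) (h : IsTotallyUniformlyMeanErgodic T) : HasSpectralDecomposition T := by
  choose p hp hz using fun χ : UnitaryChar S => h χ⁻¹
  have hfix : ∀ χ s, app (twist χ⁻¹ T) s * p χ = p χ := fun χ s =>
    (hz χ _ (app_mem_closedHull _ s)).1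
  have hproj := fun χ => mean_ergodic_projection (hp χ) (hfix χ)
  -- The bicommutant is a commutative Banach algebra containing every $T_s$ and, being closed, every
  -- $p_\chi$.
  let B := Subalgebra.centralizer ℂ (Set.centralizer (Set.range (app T)))
  have hBcl : IsClosed (B : Set (E →L[ℂ] E)) := Set.isClosed_centralizer _
  have hTB : ∀ s, app T s ∈ B := fun s => Set.subset_centralizer_centralizer ⟨s, rfl⟩
  have hpB : ∀ χ, p χ ∈ B := fun χ =>
    closedHull_subset (T := twist χ⁻¹ T) hBcl
      (fun x hx y hy a b _ _ _ => B.add_mem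
        (B.smul_mem hx (a : ℂ)) (B.smul_mem hy (b : ℂ)))
      (fun s => B.smul_mem (hTB s) _) (hp χ)
  have hBcomm : ∀ x y : B, x * y = y * x := fun x y => Subtype.ext
    (Set.centralizer_centralizer_comm_of_comm (S := Set.range (app T)) (by
      rintro _ ⟨s, rfl⟩ _ ⟨t, rfl⟩
      exact app_comm T s t) x x.2 y y.2)
  let _ : NormedCommRing B := { (inferInstance : NormedRing B) with mul_comm := hBcomm }
  have _ : CompleteSpace B := hBcl.completeSpace_coe
  let TB : Rep S B :=
    { toFun := fun s => ⟨T s, hTB s.toAdd⟩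
      map_one' := Subtype.ext (map_one T)
      map_mul' := fun s t => Subtype.ext (map_mul T s t) }
  have hone : ∀ χ (φ : WeakDual.characterSpace ℂ B), (∀ s, φ (app TB s) = charVal χ s) →
      φ ⟨p χ, hpB χ⟩ = 1 := by
    intro χ φ hφ
    let D : Set B := Set.range fun s => charVal χ⁻¹ s • app TB s
    have hD : (fun b : B => (b : E →L[ℂ] E)) '' D = Set.range (app (twist χ⁻¹ T)) := by
      rw [← Set.range_comp]
      rfl
    have hmem : (⟨p χ, hpB χ⟩ : B) ∈ closure (convexHull ℝ D) := by
      rw [Topology.IsInducing.subtypeVal.closure_eq_preimage_closure_image, Set.mem_preimage]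
      have himg := ((B.val.restrictScalars ℝ).toLinearMap).image_convexHull D
      change p χ ∈ closure ((fun b : B => (b : E →L[ℂ] E)) '' convexHull ℝ D)
      have himg' : (fun b : B => (b : E →L[ℂ] E)) '' convexHull ℝ D =
        convexHull ℝ ((fun b : B => (b : E →L[ℂ] E)) '' D) := himg
      rw [himg', hD]
      exact hp χ
    -- By hypothesis $\varphi$ equals $1$ on the rotated operators, hence on their closed convex
    -- hull.
    have hsub : closure (convexHull ℝ D) ⊆ {b | φ b = 1} := by
      refine closure_minimal (convexHull_min ?_ ?_) (isClosed_eq (map_continuous φ)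
        continuous_const)
      · rintro _ ⟨s, rfl⟩
        change φ (charVal χ⁻¹ s • app TB s) = 1
        rw [map_smul, hφ, charVal_inv, smul_eq_mul, inv_mul_cancel₀ (charVal_ne_zero χ s)]
      · intro x hx y hy a b _ _ hab
        have hx' : φ x = 1 := hx
        have hy' : φ y = 1 := hy
        change φ ((a : ℂ) • x + (b : ℂ) • y) = 1
        rw [map_add, map_smul, map_smul, hx', hy', smul_eq_mul, smul_eq_mul, mul_one, mul_one]
        exact_mod_cast hab
    exact hsub hmem
  obtain ⟨F, hF⟩ := exists_finset_tendsto_zero (T := TB) hT (fun χ => ⟨p χ, hpB χ⟩)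
    (fun χ s => Subtype.ext (app_twist_mul_eq_iff.1 (hfix χ s)))
    (fun χ => Subtype.ext (hproj χ).1) hone
  refine hasSpectralDecomposition_of_projections p (fun χ => (hproj χ).1)
    (fun χ => (hproj χ).2.1) (fun χ => (hproj χ).2.2) F ?_
  have := (continuous_subtype_val.tendsto _).comp hF
  simp only [Function.comp_def, B.coe_mul, B.coe_sub, B.coe_one, AddSubmonoidClass.coe_finsetSum,
      ZeroMemClass.coe_zero] at this
  exact this

lemma isClosed_eigenspace (χ : UnitaryChar S) : IsClosed (eigenspace χ T : Set E) := by
  have : (eigenspace χ T : Set E) = ⋂ s, {x | app T s x = charVal χ s • x} := by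
    ext x
    simp [eigenspace]
  rw [this]
  exact isClosed_iInter fun s => isClosed_eq (app T s).continuous (continuous_const_smul _)

lemma HasSpectralDecomposition.isNormConstrictive [CompleteSpace E]
    (h : HasSpectralDecomposition T) : IsNormConstrictive T := by
  classical
  obtain ⟨Er, Es, -, hEs, hcompl, -, ⟨n, χ, hind, rfl⟩, hs, hlim⟩ := h
  have : ∀ k, CompleteSpace (eigenspace (χ k) T) := fun k =>
    (isClosed_eigenspace (χ k)).completeSpace_coe
  have : CompleteSpace Es := hEs.completeSpace_coe
  let Φ : ((∀ k, eigenspace (χ k) T) × Es) →L[ℂ] E :=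
    (∑ k, (eigenspace (χ k) T).subtypeL ∘L ContinuousLinearMap.proj k ∘L
      ContinuousLinearMap.fst ℂ _ _) + Es.subtypeL ∘L ContinuousLinearMap.snd ℂ _ _
  have hΦ : ∀ z, Φ z = ∑ k, (z.1 k : E) + z.2 := fun z => by
    simp [Φ, sum_apply]
  have hker : (Φ : ((∀ k, eigenspace (χ k) T) × Es) →ₗ[ℂ] E).ker = ⊥ := by
    rw [LinearMap.ker_eq_bot']
    intro z hz
    replace hz : ∑ k, (z.1 k : E) + z.2 = 0 := (hΦ z).symm.trans hz
    have hsum : ∑ k, (z.1 k : E) ∈ ⨆ k, eigenspace (χ k) T :=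
      Submodule.sum_mem _ fun k _ => Submodule.mem_iSup_of_mem k (z.1 k).2
    have h1 : ∑ k, (z.1 k : E) = 0 := by
      refine Submodule.disjoint_def.1 hcompl.disjoint _ hsum ?_
      rw [eq_neg_of_add_eq_zero_left hz]
      exact Es.neg_mem z.2.2
    have h2 : (z.2 : E) = 0 := by rwa [h1, zero_add] at hz
    have h3 := (iSupIndep_iff_finsetSum_eq_zero_imp_eq_zero _).1 hind Finset.univ
      (fun k => (z.1 k : E)) (fun k _ => (z.1 k).2) h1
    exact Prod.ext (funext fun k => Subtype.ext (h3 k (Finset.mem_univ k))) (Subtype.ext h2)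
  have hran : (Φ : ((∀ k, eigenspace (χ k) T) × Es) →ₗ[ℂ] E).range = ⊤ := by
    rw [eq_top_iff, ← hcompl.sup_eq_top]
    refine sup_le (iSup_le fun k x hx => ⟨(Pi.single k ⟨x, hx⟩, 0), ?_⟩)
      fun x hx => ⟨(0, ⟨x, hx⟩), ?_⟩
    · change Φ _ = x
      rw [hΦ, Finset.sum_eq_single k]
      · simp
      · intro j _ hj
        simp [Pi.single_eq_of_ne hj]
      · simp
    · change Φ _ = x
      rw [hΦ]
      simp
  -- By the open mapping theorem the algebraic decomposition has bounded coordinate projections.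
  let Ψ := ContinuousLinearEquiv.ofBijective Φ hker hran
  have hΨ : ∀ x, Φ (Ψ.symm x) = x := fun x => Ψ.apply_symm_apply x
  let π : Fin n → E →L[ℂ] E := fun k =>
    (eigenspace (χ k) T).subtypeL ∘L ContinuousLinearMap.proj k ∘L
      ContinuousLinearMap.fst ℂ _ _ ∘L Ψ.symm.toContinuousLinearMap
  let σ : E →L[ℂ] Es := ContinuousLinearMap.snd ℂ _ _ ∘L Ψ.symm.toContinuousLinearMap
  have hdecomp : ∀ s, app T s = ∑ k, charVal (χ k) s • π k +
      Es.subtypeL ∘L app (restrict T Es hs) s ∘L σ := by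
    intro s
    ext x
    nth_rw 1 [← hΨ x]
    rw [hΦ, map_add, map_sum, add_apply, sum_apply]
    refine congrArg₂ _ (Finset.sum_congr rfl fun k _ => ?_) rfl
    exact ((Ψ.symm x).1 k).2 s
  -- Although the eigenspaces may be infinite-dimensional, the reversible part of $T_s$ depends only
  -- on $(\chi_k(s))_k$, a point of the compact unit ball of $\mathbb C^n$.
  let D : (Fin n → ℂ) → E →L[ℂ] E := fun z => ∑ k, z k • π k
  have hD : IsCompact (D '' Metric.closedBall 0 1) :=
    (isCompact_closedBall 0 1).image (by fun_prop)
  refine ⟨_, (Metric.nonempty_closedBall.2 zero_le_one).image D,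
    by rwa [hD.isClosed.closure_eq], ?_⟩
  have hbound : ∀ s, Metric.infDist (app T s) (D '' Metric.closedBall 0 1) ≤
      ‖Es.subtypeL‖ * (‖app (restrict T Es hs) s‖ * ‖σ‖) := by
    intro s
    have hmem : D (fun k => charVal (χ k) s) ∈ D '' Metric.closedBall 0 1 := by
      refine ⟨_, ?_, rfl⟩
      rw [mem_closedBall_zero_iff, pi_norm_le_iff_of_nonneg zero_le_one]
      exact fun k => (norm_charVal _ _).le
    refine (Metric.infDist_le_dist_of_mem hmem).trans ?_
    rw [dist_eq_norm, hdecomp s, add_sub_cancel_left]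
    exact (ContinuousLinearMap.opNorm_comp_le _ _).trans (mul_le_mul_of_nonneg_left
      (ContinuousLinearMap.opNorm_comp_le _ _) (norm_nonneg _))
  refine squeeze_zero (fun _ => Metric.infDist_nonneg) hbound ?_
  simpa using ((tendsto_zero_iff_norm_tendsto_zero (E := Es →L[ℂ] Es).1 hlim).mul_const
    ‖σ‖).const_mul ‖Es.subtypeL‖

end Decomposition

end SemigroupRep

/-! ### The equivalence -/

theorem theorem3p7 {S : Type u} [AddCommMonoid S]
    {E : Type v} [NormedAddCommGroup E] [NormedSpace ℂ E] [CompleteSpace E]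
    (T : SemigroupRep.Rep S (E →L[ℂ] E)) (hT : SemigroupRep.IsBoundedRep T) :
    List.TFAE [
      (SemigroupRep.semigroupAtInfinity T).Nonempty ∧
        IsCompact (SemigroupRep.semigroupAtInfinity T),
      SemigroupRep.EverySubnetHasConvergentSubnet.{u, v, w} T,
      ∃ I : Set (E →L[ℂ] E),
        SemigroupRep.IsSemigroupIdeal (closure (Set.range (SemigroupRep.app T))) I ∧ IsCompact I,
      SemigroupRep.IsNormConstrictive T,
      SemigroupRep.IsTotallyUniformlyMeanErgodic T,
      ∀ χ ∈ SemigroupRep.unitarySpectrum T, SemigroupRep.IsPole χ T,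
      SemigroupRep.HasSpectralDecomposition T] := by
  tfae_have 1 → 3 := fun h => ⟨_, SemigroupRep.isSemigroupIdeal_semigroupAtInfinity h.1, h.2⟩
  tfae_have 3 → 4 := fun ⟨_, hI, hc⟩ => hI.isNormConstrictive hT hc
  tfae_have 4 → 2 := fun h => h.convergesAlongUltrafilters.everySubnetHasConvergentSubnet
  tfae_have 2 → 1 := fun h =>
    ⟨h.convergesAlongUltrafilters.nonempty_semigroupAtInfinity,
      h.convergesAlongUltrafilters.isCompact_semigroupAtInfinity⟩
  tfae_have 4 → 5 := fun h χ =>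
    (h.convergesAlongUltrafilters.twist χ).isUniformlyMeanErgodic (hT.twist χ)
  tfae_have 6 ↔ 5 := SemigroupRep.forall_isPole_iff hT
  tfae_have 5 → 7 := fun h => h.hasSpectralDecomposition hT
  tfae_have 7 → 4 := fun h => h.isNormConstrictive
  tfae_finish
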